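/- Let $L^2=L^2(\mathbb T)$ with normalized Lebesgue measure and inner product linear in the first argument, let $H^2\subset L^2$ be the Hardy space (functions whose Fourier coefficients of negative index vanish), and let $P$ be the orthogonal projection of $L^2$ onto $H^2$. An inner function is a $u\in H^2$ with $|u|=1$ a.e. on $\mathbb T$; its model space is $K_u=H^2\ominus uH^2$, $P_u$ is the orthogonal projection of $L^2$ onto $K_u$, and $k_0^u=1-\overline{u(0)}\,u$. For $f\in L^2$ put $\widehat f(z)=\overline{f(\overline z)}$ and $Jf(z)=\overline z f(\overline z)$; for $f,g\in L^2$ let $f\otimes g$ be the operator $h\mapsto\langle h,g\rangle f$. For inner $u,v$ and $\varphi\in L^2$, the operators $A^{u,v}_\varphi f=P_v(\varphi f)$ and $B^{u,v}_\varphi f=P_vJ(I-P)(\varphi f)$ (an ATTO and an ATHO, respectively) are defined on the dense subspace of essentially bounded $f\in K_u$; when bounded they are extended to all of $K_u$. $\mathcal T(u,v)$ is the set of bounded operators $K_u\to K_v$ of the form $A^{u,v}_\varphi$ with $\varphi\in L^2$, and $\mathcal H(u,v)$ the set of those of the form $B^{u,v}_\varphi$ with $\varphi\in L^2$. Theorem.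 Let $u,v,w$ be inner functions, let $\phi_1\in\overline{K_{v\widehat w}}$ and $\phi_2\in\overline{K_{u\widehat v}}$, and suppose that $B^{v,w}_{\phi_1}$ and $B^{u,v}_{\phi_2}$ are bounded, i.e. $B^{v,w}_{\phi_1}\in\mathcal H(v,w)$ and $B^{u,v}_{\phi_2}\in\mathcal H(u,v)$. Then $B^{v,w}_{\phi_1}B^{u,v}_{\phi_2}\in\mathcal T(u,w)$ if and only if there are $\Phi\in K_w$ and $\Psi\in K_u$ such that, as operators on $K_u$, $$P_w\overline{\widehat v\,\widehat{\phi_1}}\otimes P_u\overline{\widehat v\,\phi_2}-P_w\overline{\widehat{\phi_1}}\otimes P_u\overline{\phi_2}=\Phi\otimes k_0^u+k_0^w\otimes\Psi .$$ -/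

import Mathlib

open MeasureTheory Set AddCircle
open scoped ENNReal ComplexConjugate InnerProductSpace

noncomputable section

namespace TruncatedHankel

/-- `L²(𝕋)`. The unit circle is modelled as `ℝ / ℤ` with its normalized Haar measure, the point `x`
standing for `z = exp (2 π i x)`; so `fourier n x` is `zⁿ` and `-x` stands for `conj z`. -/
abbrev L2 : Type := Lp ℂ 2 (haarAddCircle (T := (1 : ℝ)))

/-- The pointwise product `f g`, whenever it is square integrable (which is the case as soon as
one of the factors is essentially bounded); otherwise `0`. -/
def mul (f g : L2) : L2 :=
  open Classical in
  if h : MemLp (fun x => f x * g x) 2 haarAddCircle then h.toLp _ else 0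

/-- The reflection `f(z) ↦ f(conj z)`. -/
def reflect (f : L2) : L2 :=
  Lp.compMeasurePreserving (fun x : AddCircle (1 : ℝ) => -x) (Measure.measurePreserving_neg _) f

/-- The conjugation `U : f ↦ f^`, where `f^(z) = conj (f (conj z))`. -/
def hat (f : L2) : L2 := star (reflect f)

/-- The flip `J f (z) = conj z * f (conj z)`. -/
def flipJ (f : L2) : L2 := mul (fourierLp 2 (-1)) (reflect f)

/-- The Hardy space `H²`, as the space of boundary functions: the `f` in `L²(𝕋)` whose Fourier
coefficients of negative index vanish. -/
def H2 : Submodule ℂ L2 where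
  carrier := {f | ∀ n : ℤ, n < 0 → fourierCoeff f n = 0}
  zero_mem' := by
    intro n _
    rw [← fourierBasis_repr]
    simp
  add_mem' := by
    intro f g hf hg n hn
    have h1 := hf n hn
    have h2 := hg n hn
    rw [← fourierBasis_repr] at h1 h2 ⊢
    rw [map_add, lp.coeFn_add, Pi.add_apply, h1, h2, add_zero]
  smul_mem' := by
    intro c f hf n hn
    have h1 := hf n hn
    rw [← fourierBasis_repr] at h1 ⊢
    rw [map_smul, lp.coeFn_smul, Pi.smul_apply, h1, smul_zero]

theorem isClosed_H2 : IsClosed (H2 : Set L2) := by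
  have h : (H2 : Set L2) = ⋂ n : ℤ, ⋂ _ : n < 0, {f | ⟪fourierBasis n, f⟫_ℂ = 0} := by
    ext f
    simp [H2, ← fourierBasis_repr, HilbertBasis.repr_apply_apply]
  rw [h]
  exact isClosed_iInter fun n => isClosed_iInter fun _ =>
    isClosed_eq (by fun_prop) continuous_const

instance : CompleteSpace H2 := isClosed_H2.completeSpace_coe

/-- Inner functions: members of `H²` of modulus one almost everywhere on `𝕋`. -/
def IsInner (u : L2) : Prop := u ∈ H2 ∧ ∀ᵐ x ∂haarAddCircle, ‖u x‖ = 1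

/-- The model space `K_u = H² ⊖ u H²`. -/
def K (u : L2) : Submodule ℂ L2 := H2 ⊓ (Submodule.span ℂ (mul u '' H2))ᗮ

theorem isClosed_K (u : L2) : IsClosed (K u : Set L2) := by
  rw [K, Submodule.coe_inf]
  exact isClosed_H2.inter (Submodule.isClosed_orthogonal _)

instance (u : L2) : CompleteSpace (K u) := (isClosed_K u).completeSpace_coe

/-- The orthogonal projection `P` of `L²` onto `H²`. -/
def P : L2 →L[ℂ] L2 := H2.starProjection

/-- The orthogonal projection `P_u` of `L²` onto `K_u`. -/
def PK (u : L2) : L2 →L[ℂ] K u := (K u).orthogonalProjectionOnto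

/-- The reproducing kernel of `K_u` at the origin, `k₀ᵘ = 1 - conj (u(0)) u`; the value `u(0)` is
the Fourier coefficient of index `0` of the boundary function. -/
def k0 (u : L2) : L2 := fourierLp 2 0 - conj (fourierCoeff u 0) • u

/-- `A : K_u → K_v` is the bounded asymmetric truncated Toeplitz operator with symbol `φ`: the
bounded operator given on the dense subspace of essentially bounded functions by
`A f = P_v (φ f)`. -/
def IsATTOWithSymbol {u v : L2} (φ : L2) (A : K u →L[ℂ] K v) : Prop :=
  ∀ f : K u, MemLp (f : L2) ∞ haarAddCircle → A f = PK v (mul φ f)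

/-- `A` belongs to `𝒯(u, v)`. -/
def IsATTO {u v : L2} (A : K u →L[ℂ] K v) : Prop := ∃ φ : L2, IsATTOWithSymbol φ A

/-- `B : K_u → K_v` is the bounded asymmetric truncated Hankel operator with symbol `φ`: the
bounded operator given on the dense subspace of essentially bounded functions by
`B f = P_v J (I - P) (φ f)`. -/
def IsATHOWithSymbol {u v : L2} (φ : L2) (B : K u →L[ℂ] K v) : Prop :=
  ∀ f : K u, MemLp (f : L2) ∞ haarAddCircle → B f = PK v (flipJ (mul φ f - P (mul φ f)))

/-- The operator `f ⊗ g : h ↦ ⟨h, g⟩ f` on `K_u`, the inner product being linear in its first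
argument. -/
def tensor {u : L2} (f g : L2) : K u →L[ℂ] L2 :=
  (InnerProductSpace.rankOne ℂ f g).comp (K u).subtypeL

end TruncatedHankel

end

open TruncatedHankel

/-!
A product of two truncated Hankel operators is compared with its conjugate by compressed shifts.
Inner products in the comments below are linear in the first argument, `S_u` denotes the
compressed shift of `K_u`, and `S_u^*` is the backward shift `f ↦ conj z (f - f(0))`, which leaves
`K_u` invariant.

Truncated Toeplitz operators are exactly the bounded operators with
`A - S_v A S_u^* = Φ ⊗ k₀ᵘ + k₀ᵛ ⊗ Ψ` for some `Φ ∈ K_v`, `Ψ ∈ K_u`. That a truncated Toeplitz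
operator has this form is a direct computation with its symbol
(`IsATTOWithSymbol.exists_defect`). Conversely, iterating the identity and using that the powers
of the backward shift tend strongly to zero expresses `⟨A f, g⟩` as a series in the Fourier
coefficients of `f` and `g`, and Parseval's identity sums it to `⟨(Φ + conj Ψ) f, g⟩`
(`HasToeplitzDefect.isATTO`).

A truncated Hankel operator satisfies instead the intertwining relation
`B S_u^* - S_v B = k₀ᵛ ⊗ P_u conj φ - P_v (conj φ^) ⊗ k₀ᵘ`
(`IsATHOWithSymbol.inner_apply_RK`). Applying it to both factors of `C = B₁ B₂`, and using
`S_v^* S_v = 1 - r ⊗ r` and `S_v^* k₀ᵛ = - conj (v(0)) r` with `r = S_v^* v = conj z (v - v(0))`,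
gives modulo operators `Φ ⊗ k₀ᵘ + k₀ʷ ⊗ Ψ`
`C - S_w C S_u^* ≡ (B₁ r + v(0) F₁) ⊗ (B₂^* r + v(0) F₂) - F₁ ⊗ F₂`,
where `F₁ = P_w (conj φ₁^)` and `F₂ = P_u (conj φ₂)`. The symbols give
`B₁ r + v(0) F₁ = P_w conj (v^ φ₁^)` and `B₂^* r + v(0) F₂ = P_u conj (v^ φ₂)`, so the defect of
`C` differs from the left-hand side of the operator identity in the theorem only by terms of the
form allowed for a truncated Toeplitz operator (`exists_defect_comp`).

Since operators are only prescribed on essentially bounded functions, all identities are checked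
there and extended by density (`dense_bdd`). They are written as identities of sesquilinear forms
in terms of `⟪g, f⟫_ℂ`, which is conjugate-linear in `g`.
-/

noncomputable section

namespace TruncatedHankel

/-- The characters `z ↦ zⁿ` as elements of `L²(𝕋)`. -/
local notation "𝐞" => (fourierLp (T := (1 : ℝ)) 2 : ℤ → L2)

/-! ### Multiplication and reflection in `L²(𝕋)` -/

/-- Essential boundedness of an element of `L²(𝕋)`. -/
abbrev Bdd (f : L2) : Prop := MemLp f ∞ haarAddCircle

theorem coeFn_mul {f g : L2} (h : Bdd f ∨ Bdd g) :
    mul f g =ᵐ[haarAddCircle] fun x => f x * g x := by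
  have h' : MemLp (fun x => f x * g x) 2 haarAddCircle := by
    rcases h with h | h
    · exact (Lp.memLp g).mul h
    · exact h.mul (Lp.memLp f)
  rw [mul, dif_pos h']
  exact h'.coeFn_toLp

theorem ae_neg {p : AddCircle (1 : ℝ) → Prop} (h : ∀ᵐ x ∂haarAddCircle, p x) :
    ∀ᵐ x ∂(haarAddCircle (T := (1 : ℝ))), p (-x) :=
  (Measure.measurePreserving_neg (haarAddCircle (T := (1 : ℝ)))).quasiMeasurePreserving.ae h

theorem coeFn_reflect (f : L2) : reflect f =ᵐ[haarAddCircle] fun x => f (-x) :=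
  Lp.coeFn_compMeasurePreserving f _

theorem coeFn_star' (f : L2) : (star f : L2) =ᵐ[haarAddCircle] fun x => conj (f x) :=
  Lp.coeFn_star f

theorem coeFn_hat (f : L2) : hat f =ᵐ[haarAddCircle] fun x => conj (f (-x)) := by
  filter_upwards [coeFn_star' (reflect f), coeFn_reflect f] with x h1 h2
  rw [hat, h1, h2]

theorem coeFn_char (n : ℤ) : 𝐞 n =ᵐ[haarAddCircle] fourier n := coeFn_fourierLp 2 n

theorem Bdd.of_norm_eq_one {f : L2} (h : ∀ᵐ x ∂haarAddCircle, ‖f x‖ = 1) : Bdd f :=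
  memLp_top_of_bound (Lp.aestronglyMeasurable f) 1 (h.mono fun _ hx => hx.le)

theorem norm_char (n : ℤ) : ∀ᵐ x ∂haarAddCircle, ‖𝐞 n x‖ = 1 := by
  filter_upwards [coeFn_char n] with x hx
  rw [hx, fourier_apply]
  exact Circle.norm_coe _

theorem bdd_char (n : ℤ) : Bdd (𝐞 n) := .of_norm_eq_one (norm_char n)

theorem IsInner.bdd {u : L2} (hu : IsInner u) : Bdd u := .of_norm_eq_one hu.2

theorem IsInner.bdd_hat {u : L2} (hu : IsInner u) : Bdd (hat u) := by
  refine .of_norm_eq_one ?_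
  filter_upwards [ae_neg hu.2, coeFn_hat u] with x h1 h2
  rw [h2, RCLike.norm_conj, h1]

theorem Bdd.star {f : L2} (hf : Bdd f) : Bdd (star f) :=
  hf.of_le (Lp.aestronglyMeasurable _) <| by
    filter_upwards [coeFn_star' f] with x hx
    rw [hx, RCLike.norm_conj]

theorem Bdd.add {f g : L2} (hf : Bdd f) (hg : Bdd g) : Bdd (f + g) :=
  (memLp_congr_ae (Lp.coeFn_add f g)).2 (MemLp.add hf hg)

theorem Bdd.smul {f : L2} (c : ℂ) (hf : Bdd f) : Bdd (c • f) :=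
  (memLp_congr_ae (Lp.coeFn_smul c f)).2 (hf.const_smul c)

theorem Bdd.sub {f g : L2} (hf : Bdd f) (hg : Bdd g) : Bdd (f - g) :=
  (memLp_congr_ae (Lp.coeFn_sub f g)).2 (MemLp.sub hf hg)

theorem bdd_zero : Bdd 0 := (memLp_congr_ae (Lp.coeFn_zero ℂ 2 haarAddCircle)).2 MemLp.zero

theorem Bdd.mul {f g : L2} (hf : Bdd f) (hg : Bdd g) : Bdd (mul f g) :=
  (memLp_congr_ae (coeFn_mul (.inl hf))).2 (MemLp.mul hg hf)

theorem mul_add' {φ f g : L2} (hφ : Bdd φ) : mul φ (f + g) = mul φ f + mul φ g := by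
  apply Lp.ext
  filter_upwards [coeFn_mul (f := φ) (g := f + g) (.inl hφ), coeFn_mul (f := φ) (g := f) (.inl hφ),
    coeFn_mul (f := φ) (g := g) (.inl hφ), Lp.coeFn_add f g,
    Lp.coeFn_add (mul φ f) (mul φ g)] with x h1 h2 h3 h4 h5
  rw [h1, h5, Pi.add_apply, h2, h3, h4, Pi.add_apply, mul_add]

theorem mul_smul' {φ f : L2} (c : ℂ) (h : Bdd φ ∨ Bdd f) : mul φ (c • f) = c • mul φ f := by
  apply Lp.ext
  filter_upwards [coeFn_mul (f := φ) (g := c • f) (h.imp_right (Bdd.smul c)), coeFn_mul h,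
    Lp.coeFn_smul c f, Lp.coeFn_smul c (mul φ f)] with x h1 h2 h3 h4
  rw [h1, h4, Pi.smul_apply, h2, h3, Pi.smul_apply, smul_eq_mul, smul_eq_mul, mul_left_comm]

theorem mul_sub_char (φ : L2) {f : L2} (c : ℂ) (hf : Bdd f) :
    mul φ (f - c • 𝐞 0) = mul φ f - c • φ := by
  apply Lp.ext
  filter_upwards [coeFn_mul (f := φ) (g := f - c • 𝐞 0) (.inr (hf.sub ((bdd_char 0).smul c))),
    coeFn_mul (f := φ) (g := f) (.inr hf), coeFn_char 0, Lp.coeFn_sub f (c • 𝐞 0),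
    Lp.coeFn_smul c (𝐞 0), Lp.coeFn_sub (mul φ f) (c • φ), Lp.coeFn_smul c φ]
    with x h1 h2 h3 h4 h5 h6 h7
  rw [h1, h6, Pi.sub_apply, h2, h7, h4, Pi.sub_apply, h5, Pi.smul_apply, Pi.smul_apply, h3,
    fourier_zero]
  simp only [smul_eq_mul]
  ring

theorem inner_mul_left' {φ f g : L2} (hφ : Bdd φ) : ⟪mul φ f, g⟫_ℂ = ⟪f, mul (star φ) g⟫_ℂ := by
  rw [L2.inner_def, L2.inner_def]
  apply integral_congr_ae
  filter_upwards [coeFn_mul (f := φ) (g := f) (.inl hφ), coeFn_mul (f := star φ) (g := g)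
    (.inl hφ.star), coeFn_star' φ] with x h1 h2 h3
  rw [h1, h2, h3]
  simp only [RCLike.inner_apply, map_mul]
  ring

theorem inner_mul_char {φ f : L2} (hf : Bdd f) : ⟪𝐞 0, mul φ f⟫_ℂ = ⟪star φ, f⟫_ℂ := by
  rw [L2.inner_def, L2.inner_def]
  apply integral_congr_ae
  filter_upwards [coeFn_mul (f := φ) (g := f) (.inr hf), coeFn_char 0, coeFn_star' φ]
    with x h1 h2 h3
  rw [h1, h2, h3, fourier_zero]
  simp only [RCLike.inner_apply, map_one, RCLike.conj_conj]
  ring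

theorem mul_char_zero (f : L2) : mul f (𝐞 0) = f := by
  apply Lp.ext
  filter_upwards [coeFn_mul (f := f) (g := 𝐞 0) (.inr (bdd_char 0)), coeFn_char 0] with x h1 h2
  rw [h1, h2, fourier_zero, mul_one]

theorem IsInner.star_mul_mul {u : L2} (hu : IsInner u) (f : L2) : mul (star u) (mul u f) = f := by
  apply Lp.ext
  filter_upwards [coeFn_mul (f := star u) (g := mul u f) (.inl hu.bdd.star),
    coeFn_mul (f := u) (g := f) (.inl hu.bdd), coeFn_star' u, hu.2] with x h1 h2 h3 h4
  rw [h1, h2, h3, ← mul_assoc, RCLike.conj_mul, h4]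
  simp

theorem IsInner.inner_mul_mul {u : L2} (hu : IsInner u) (f g : L2) :
    ⟪mul u f, mul u g⟫_ℂ = ⟪f, g⟫_ℂ := by
  rw [inner_mul_left' hu.bdd, hu.star_mul_mul]

/-- Multiplication by `zⁿ`, an isometry of `L²(𝕋)`. -/
def M (n : ℤ) : L2 →ₗᵢ[ℂ] L2 where
  toFun f := mul (𝐞 n) f
  map_add' _ _ := mul_add' (bdd_char n)
  map_smul' c _ := mul_smul' c (.inl (bdd_char n))
  norm_map' f := by
    refine (Lp.norm_def _).trans ((congrArg _ (eLpNorm_congr_norm_ae ?_)).trans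
      (Lp.norm_def _).symm)
    filter_upwards [coeFn_mul (f := 𝐞 n) (g := f) (.inl (bdd_char n)), norm_char n] with x h1 h2
    change ‖mul (𝐞 n) f x‖ = _
    rw [h1, norm_mul, h2, one_mul]

theorem coeFn_M (n : ℤ) (f : L2) : M n f =ᵐ[haarAddCircle] fun x => fourier n x * f x := by
  filter_upwards [coeFn_mul (f := 𝐞 n) (g := f) (.inl (bdd_char n)), coeFn_char n] with x h1 h2
  rw [← h2]; exact h1

theorem Bdd.M {f : L2} (n : ℤ) (hf : Bdd f) : Bdd (M n f) := (bdd_char n).mul hf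

theorem M_M (m n : ℤ) (f : L2) : M m (M n f) = M (m + n) f := by
  apply Lp.ext
  filter_upwards [coeFn_M m (M n f), coeFn_M n f, coeFn_M (m + n) f] with x h1 h2 h3
  rw [h1, h2, h3, fourier_add, mul_assoc]

theorem M_zero (f : L2) : M 0 f = f := by
  apply Lp.ext
  filter_upwards [coeFn_M 0 f] with x h1
  rw [h1, fourier_zero, one_mul]

theorem M_char (m n : ℤ) : M m (𝐞 n) = 𝐞 (m + n) := by
  apply Lp.ext
  filter_upwards [coeFn_M m (𝐞 n), coeFn_char n, coeFn_char (m + n)] with x h1 h2 h3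
  rw [h1, h2, h3, fourier_add]

theorem inner_M_right (n : ℤ) (f g : L2) : ⟪f, M n g⟫_ℂ = ⟪M (-n) f, g⟫_ℂ := by
  rw [← (M (-n)).inner_map_map f (M n g), M_M, neg_add_cancel, M_zero]

theorem mul_M {f g : L2} (n : ℤ) (h : Bdd f ∨ Bdd g) : mul f (M n g) = M n (mul f g) := by
  apply Lp.ext
  filter_upwards [coeFn_mul (f := f) (g := M n g) (h.imp_right (Bdd.M n)), coeFn_mul h,
    coeFn_M n g, coeFn_M n (mul f g)] with x h1 h2 h3 h4
  rw [h1, h4, h2, h3, mul_left_comm]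

theorem reflect_sub (f g : L2) : reflect (f - g) = reflect f - reflect g :=
  map_sub (Lp.compMeasurePreserving _ (Measure.measurePreserving_neg _)) f g

theorem reflect_smul (c : ℂ) (f : L2) : reflect (c • f) = c • reflect f :=
  (Lp.compMeasurePreservingₗᵢ ℂ _ (Measure.measurePreserving_neg
    (haarAddCircle (T := (1 : ℝ))))).map_smul c f

theorem inner_reflect_reflect (f g : L2) : ⟪reflect f, reflect g⟫_ℂ = ⟪f, g⟫_ℂ :=
  (Lp.compMeasurePreservingₗᵢ ℂ _ (Measure.measurePreserving_neg
    (haarAddCircle (T := (1 : ℝ))))).inner_map_map f g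

theorem reflect_M (n : ℤ) (f : L2) : reflect (M n f) = M (-n) (reflect f) := by
  apply Lp.ext
  filter_upwards [coeFn_reflect (M n f), ae_neg (coeFn_M n f), coeFn_M (-n) (reflect f),
    coeFn_reflect f] with x h1 h2 h3 h4
  rw [h1, h2, h3, h4]
  simp [fourier_apply]

theorem reflect_char (n : ℤ) : reflect (𝐞 n) = 𝐞 (-n) := by
  apply Lp.ext
  filter_upwards [coeFn_reflect (𝐞 n), ae_neg (coeFn_char n), coeFn_char (-n)] with x h1 h2 h3
  rw [h1, h2, h3]
  simp [fourier_apply]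

theorem reflect_reflect (f : L2) : reflect (reflect f) = f := by
  apply Lp.ext
  filter_upwards [coeFn_reflect (reflect f), ae_neg (coeFn_reflect f)] with x h1 h2
  rw [h1, h2, neg_neg]

theorem star_hat (f : L2) : star (hat f) = reflect f := star_star _

theorem star_mul_hat_hat {v : L2} (φ : L2) (hv : IsInner v) :
    star (mul (hat v) (hat φ)) = reflect (mul φ v) := by
  apply Lp.ext
  filter_upwards [coeFn_star' (mul (hat v) (hat φ)), coeFn_mul (f := hat v) (g := hat φ)
    (.inl hv.bdd_hat), coeFn_hat v, coeFn_hat φ, coeFn_reflect (mul φ v),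
    ae_neg (coeFn_mul (f := φ) (g := v) (.inr hv.bdd))] with x h1 h2 h3 h4 h5 h6
  rw [h1, h2, h3, h4, h5, h6, map_mul, RCLike.conj_conj, RCLike.conj_conj, mul_comm]

theorem inner_reflect_mul {v f : L2} (φ : L2) (hv : IsInner v) (hf : Bdd f) :
    ⟪v, reflect (mul φ f)⟫_ℂ = ⟪star (mul (hat v) φ), f⟫_ℂ := by
  rw [← inner_reflect_reflect, reflect_reflect, L2.inner_def, L2.inner_def]
  apply integral_congr_ae
  filter_upwards [coeFn_reflect v, coeFn_mul (f := φ) (g := f) (.inr hf),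
    coeFn_star' (mul (hat v) φ), coeFn_mul (f := hat v) (g := φ) (.inl hv.bdd_hat), coeFn_hat v]
    with x h1 h2 h3 h4 h5
  rw [h1, h2, h3, h4, h5]
  simp only [RCLike.inner_apply, map_mul, RCLike.conj_conj]
  ring

/-! ### The Hardy space -/

theorem mem_H2_iff {f : L2} : f ∈ H2 ↔ ∀ n : ℤ, n < 0 → ⟪𝐞 n, f⟫_ℂ = 0 := by
  simp only [H2, ← fourierBasis_repr, HilbertBasis.repr_apply_apply, coe_fourierBasis]
  rfl

theorem fourierCoeff_eq_inner (f : L2) (n : ℤ) : fourierCoeff f n = ⟪𝐞 n, f⟫_ℂ := by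
  rw [← fourierBasis_repr, HilbertBasis.repr_apply_apply, coe_fourierBasis]

theorem hasSum_inner_char (f g : L2) :
    HasSum (fun n : ℤ => ⟪f, 𝐞 n⟫_ℂ * ⟪𝐞 n, g⟫_ℂ) ⟪f, g⟫_ℂ := by
  simpa only [coe_fourierBasis] using (fourierBasis (T := (1 : ℝ))).hasSum_inner_mul_inner f g

theorem inner_eq_zero_of_coeff {f g : L2} (h : ∀ n : ℤ, ⟪𝐞 n, f⟫_ℂ = 0 ∨ ⟪𝐞 n, g⟫_ℂ = 0) :
    ⟪f, g⟫_ℂ = 0 := by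
  refine (hasSum_inner_char f g).unique ?_
  convert! hasSum_zero (α := ℂ) (β := ℤ) using 2 with n
  rcases h n with h | h
  · rw [inner_eq_zero_symm.1 h, zero_mul]
  · rw [h, mul_zero]

theorem eq_of_coeff {f g : L2} (h : ∀ n : ℤ, ⟪𝐞 n, f⟫_ℂ = ⟪𝐞 n, g⟫_ℂ) : f = g := by
  rw [← sub_eq_zero, ← inner_self_eq_zero (𝕜 := ℂ)]
  exact inner_eq_zero_of_coeff fun n => .inl (by rw [inner_sub_right, h, sub_self])

theorem inner_char_char (m n : ℤ) : ⟪𝐞 m, 𝐞 n⟫_ℂ = if m = n then 1 else 0 :=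
  orthonormal_iff_ite.1 (orthonormal_fourier (T := (1 : ℝ))) m n

theorem inner_char_M (m n : ℤ) (f : L2) : ⟪𝐞 m, M n f⟫_ℂ = ⟪𝐞 (m - n), f⟫_ℂ := by
  rw [inner_M_right, M_char, neg_add_eq_sub]

theorem inner_char_reflect (n : ℤ) (f : L2) : ⟪𝐞 n, reflect f⟫_ℂ = ⟪𝐞 (-n), f⟫_ℂ := by
  rw [← inner_reflect_reflect, reflect_reflect, reflect_char]

theorem char_mem_H2 {n : ℤ} (hn : 0 ≤ n) : 𝐞 n ∈ H2 :=
  mem_H2_iff.2 fun m hm => by rw [inner_char_char, if_neg (by lia)]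

theorem M_mem_H2 {f : L2} (hf : f ∈ H2) {n : ℤ} (hn : 0 ≤ n) : M n f ∈ H2 :=
  mem_H2_iff.2 fun m hm => by rw [inner_char_M, mem_H2_iff.1 hf _ (by lia)]

theorem mul_char {u : L2} (n : ℤ) : mul u (𝐞 n) = M n u := by
  rw [← add_zero n, ← M_char, mul_M _ (.inr (bdd_char 0)), mul_char_zero, add_zero]

/-- An inner function multiplies `H²` into itself: for `m < 0` the functions `p ∈ H²` and
`conj u zᵐ` have disjoint Fourier spectra. -/
theorem mul_mem_H2 {u p : L2} (hu : IsInner u) (hp : p ∈ H2) : mul u p ∈ H2 := by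
  refine mem_H2_iff.2 fun m hm => inner_eq_zero_symm.1 ?_
  rw [inner_mul_left' hu.bdd]
  refine inner_eq_zero_of_coeff fun n => ?_
  by_cases hn : n < 0
  · exact .inl (mem_H2_iff.1 hp n hn)
  · right
    rw [← inner_mul_left' hu.bdd, mul_char, inner_eq_zero_symm, inner_char_M]
    exact mem_H2_iff.1 hu.1 _ (by lia)

/-- The flip `J` maps `H²` into its orthogonal complement. -/
theorem inner_flipJ_eq_zero {g h : L2} (hg : g ∈ H2) (hh : h ∈ H2) : ⟪g, flipJ h⟫_ℂ = 0 := by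
  refine inner_eq_zero_of_coeff fun n => ?_
  by_cases hn : n < 0
  · exact .inl (mem_H2_iff.1 hg n hn)
  · right
    change ⟪𝐞 n, M (-1) (reflect h)⟫_ℂ = 0
    rw [inner_char_M, inner_char_reflect]
    exact mem_H2_iff.1 hh _ (by lia)

/-! ### Model spaces and the backward shift -/

theorem mem_K_iff {u f : L2} : f ∈ K u ↔ f ∈ H2 ∧ ∀ p ∈ H2, ⟪mul u p, f⟫_ℂ = 0 := by
  rw [K, Submodule.mem_inf, Submodule.mem_orthogonal]
  refine and_congr_right fun _ => ⟨fun h p hp => h _ (Submodule.subset_span ⟨p, hp, rfl⟩),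
    fun h x hx => ?_⟩
  induction hx using Submodule.span_induction with
  | mem x hx => obtain ⟨p, hp, rfl⟩ := hx; exact h p hp
  | zero => exact inner_zero_left _
  | add x y _ _ hx hy => rw [inner_add_left, hx, hy, add_zero]
  | smul c x _ hx => rw [inner_smul_left, hx, mul_zero]

theorem inner_inner_eq_zero {u : L2} (f : K u) : ⟪u, (f : L2)⟫_ℂ = 0 := by
  simpa only [mul_char_zero] using (mem_K_iff.1 f.2).2 _ (char_mem_H2 le_rfl)

theorem inner_k0 {u : L2} (f : K u) : ⟪k0 u, (f : L2)⟫_ℂ = ⟪𝐞 0, (f : L2)⟫_ℂ := by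
  rw [k0, inner_sub_left, inner_smul_left, inner_inner_eq_zero, mul_zero, sub_zero]

theorem inner_k0_right {u : L2} (f : K u) : ⟪(f : L2), k0 u⟫_ℂ = ⟪(f : L2), 𝐞 0⟫_ℂ := by
  rw [← inner_conj_symm, inner_k0, inner_conj_symm]

theorem inner_PK {u : L2} (g : K u) (h : L2) : ⟪g, PK u h⟫_ℂ = ⟪(g : L2), h⟫_ℂ :=
  Submodule.inner_orthogonalProjectionOnto_eq_of_mem_left g h

theorem inner_PK_left {u : L2} (g : K u) (h : L2) : ⟪PK u h, g⟫_ℂ = ⟪h, (g : L2)⟫_ℂ :=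
  Submodule.inner_orthogonalProjectionOnto_eq_of_mem_right g h

/-- The general `inner_smul_right`, whose rewriting pattern does not match scalar multiplication
in `K u`. -/
theorem inner_smul_right_K {u : L2} (c : ℂ) (g h : K u) : ⟪g, c • h⟫_ℂ = c * ⟪g, h⟫_ℂ :=
  inner_smul_right (g : L2) (h : L2) c

/-- The general `inner_smul_left` for scalar multiplication in `K u`. -/
theorem inner_smul_left_K {u : L2} (c : ℂ) (g h : K u) : ⟪c • g, h⟫_ℂ = conj c * ⟪g, h⟫_ℂ :=
  inner_smul_left (g : L2) (h : L2) c

/-- The backward shift `f ↦ conj z (f - f(0))`, defined on all of `L²(𝕋)`, where `f(0)` stands for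
the Fourier coefficient of index `0`. -/
def R : L2 →L[ℂ] L2 :=
  (M (-1)).toContinuousLinearMap.comp
    (ContinuousLinearMap.id ℂ L2 - InnerProductSpace.rankOne ℂ (𝐞 0) (𝐞 0))

theorem R_apply (f : L2) : R f = M (-1) (f - ⟪𝐞 0, f⟫_ℂ • 𝐞 0) := rfl

theorem Bdd.R {f : L2} (hf : Bdd f) : Bdd (R f) := by
  rw [R_apply]
  exact (hf.sub ((bdd_char 0).smul _)).M _

theorem inner_R_M (f g : L2) : ⟪R f, M (-1) g⟫_ℂ = ⟪f, g⟫_ℂ - ⟪f, 𝐞 0⟫_ℂ * ⟪𝐞 0, g⟫_ℂ := by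
  rw [R_apply, (M (-1)).inner_map_map, inner_sub_left, inner_smul_left, inner_conj_symm]

theorem inner_R_R (f g : L2) : ⟪R f, R g⟫_ℂ = ⟪f, g⟫_ℂ - ⟪f, 𝐞 0⟫_ℂ * ⟪𝐞 0, g⟫_ℂ := by
  rw [R_apply g, inner_R_M, inner_sub_right, inner_sub_right, inner_smul_right, inner_smul_right,
    inner_char_char, if_pos rfl]
  ring

theorem inner_char_R_neg_one (f : L2) : ⟪𝐞 (-1), R f⟫_ℂ = 0 := by
  rw [R_apply, inner_char_M, inner_sub_right, inner_smul_right, inner_char_char]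
  simp

theorem inner_char_R {n : ℤ} (hn : n ≠ -1) (f : L2) : ⟪𝐞 n, R f⟫_ℂ = ⟪𝐞 (n + 1), f⟫_ℂ := by
  rw [R_apply, inner_char_M, inner_sub_right, inner_smul_right, inner_char_char,
    if_neg (by lia), mul_zero, sub_zero, sub_neg_eq_add]

theorem R_mem_H2 {f : L2} (hf : f ∈ H2) : R f ∈ H2 := by
  refine mem_H2_iff.2 fun n hn => ?_
  by_cases h : n = -1
  · rw [h, inner_char_R_neg_one]
  · rw [inner_char_R h, mem_H2_iff.1 hf _ (by lia)]

theorem inner_R_right {p : L2} (hp : p ∈ H2) (f : L2) : ⟪p, R f⟫_ℂ = ⟪M 1 p, f⟫_ℂ := by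
  rw [R_apply, inner_M_right, neg_neg, inner_sub_right, inner_smul_right]
  rw [inner_eq_zero_symm (y := 𝐞 0) |>.2, mul_zero, sub_zero]
  rw [inner_char_M]
  exact mem_H2_iff.1 hp _ (by lia)

theorem R_mem_K {u : L2} (hu : IsInner u) {f : L2} (hf : f ∈ K u) : R f ∈ K u := by
  rw [mem_K_iff] at hf ⊢
  refine ⟨R_mem_H2 hf.1, fun p hp => ?_⟩
  rw [inner_R_right (mul_mem_H2 hu hp), ← mul_M _ (.inl hu.bdd)]
  exact hf.2 _ (M_mem_H2 hp zero_le_one)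

theorem R_self_mem_K {u : L2} (hu : IsInner u) : R u ∈ K u := by
  refine mem_K_iff.2 ⟨R_mem_H2 hu.1, fun p hp => ?_⟩
  rw [inner_R_right (mul_mem_H2 hu hp), ← mul_M _ (.inl hu.bdd)]
  nth_rw 2 [← mul_char_zero u]
  rw [hu.inner_mul_mul, inner_eq_zero_symm, inner_char_M]
  exact mem_H2_iff.1 hp _ (by lia)

theorem eq_char_add_M_R (p : L2) : p = ⟪𝐞 0, p⟫_ℂ • 𝐞 0 + M 1 (R p) := by
  rw [R_apply, M_M, show (1 : ℤ) + -1 = 0 from rfl, M_zero, add_sub_cancel]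

theorem inner_mul_char_zero {u p : L2} (hu : IsInner u) (hp : p ∈ H2) :
    ⟪mul u p, 𝐞 0⟫_ℂ = ⟪p, 𝐞 0⟫_ℂ * ⟪u, 𝐞 0⟫_ℂ := by
  have h0 : ⟪M 1 (mul u (R p)), 𝐞 0⟫_ℂ = 0 := by
    rw [inner_eq_zero_symm, inner_char_M]
    exact mem_H2_iff.1 (mul_mem_H2 hu (R_mem_H2 hp)) _ (by lia)
  conv_lhs => rw [eq_char_add_M_R p]
  rw [mul_add' hu.bdd, mul_smul' _ (.inl hu.bdd), mul_char_zero, mul_M _ (.inl hu.bdd),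
    inner_add_left, inner_smul_left, h0, inner_conj_symm, add_zero]

theorem k0_mem_K {u : L2} (hu : IsInner u) : k0 u ∈ K u := by
  refine mem_K_iff.2 ⟨H2.sub_mem (char_mem_H2 le_rfl) (H2.smul_mem _ hu.1), fun p hp => ?_⟩
  have h : ⟪mul u p, u⟫_ℂ = ⟪p, 𝐞 0⟫_ℂ := by
    nth_rw 2 [← mul_char_zero u]
    rw [hu.inner_mul_mul]
  rw [k0, inner_sub_right, inner_smul_right, inner_mul_char_zero hu hp, h, fourierCoeff_eq_inner,
    inner_conj_symm, mul_comm, sub_self]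

theorem R_k0 (u : L2) : R (k0 u) = -(⟪u, 𝐞 0⟫_ℂ • R u) := by
  have h : R (𝐞 0) = 0 := by
    rw [R_apply, inner_char_char, if_pos rfl, one_smul, sub_self, map_zero]
  rw [k0, map_sub, h, zero_sub, map_smul, fourierCoeff_eq_inner, inner_conj_symm]

theorem inner_char_k0 (u : L2) : ⟪𝐞 0, k0 u⟫_ℂ = 1 - ⟪u, 𝐞 0⟫_ℂ * ⟪𝐞 0, u⟫_ℂ := by
  rw [k0, inner_sub_right, inner_smul_right, fourierCoeff_eq_inner, inner_conj_symm,
    inner_char_char, if_pos rfl]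

/-- The backward shift as an operator on the model space `K_u`. -/
def RK {u : L2} (hu : IsInner u) : K u →L[ℂ] K u :=
  (R.comp (K u).subtypeL).codRestrict (K u) fun f => R_mem_K hu f.2

@[simp]
theorem coe_RK {u : L2} (hu : IsInner u) (f : K u) : (RK hu f : L2) = R f := rfl

/-- The compressed shift, the adjoint of the backward shift on `K_u`, is `h ↦ z h - ⟨z h, u⟩ u`. -/
theorem coe_adjoint_RK {u : L2} (hu : IsInner u) (h : K u) :
    ((RK hu).adjoint h : L2) = M 1 h - ⟪R u, (h : L2)⟫_ℂ • u := by
  have hR : ⟪R u, (h : L2)⟫_ℂ = ⟪u, M 1 (h : L2)⟫_ℂ := by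
    rw [← inner_conj_symm, inner_R_right (mem_K_iff.1 h.2).1, inner_conj_symm]
  have hm : M 1 (h : L2) - ⟪R u, (h : L2)⟫_ℂ • u ∈ K u := by
    refine mem_K_iff.2 ⟨H2.sub_mem (M_mem_H2 (mem_K_iff.1 h.2).1 zero_le_one)
      (H2.smul_mem _ hu.1), fun p hp => ?_⟩
    have h1 : ⟪mul u p, u⟫_ℂ = ⟪p, 𝐞 0⟫_ℂ := by
      nth_rw 2 [← mul_char_zero u]
      rw [hu.inner_mul_mul]
    have h2 : ⟪mul u p, M 1 (h : L2)⟫_ℂ = ⟪p, 𝐞 0⟫_ℂ * ⟪u, M 1 (h : L2)⟫_ℂ := by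
      have h3 : ⟪M 1 (mul u (R p)), M 1 (h : L2)⟫_ℂ = 0 := by
        rw [(M 1).inner_map_map]
        exact (mem_K_iff.1 h.2).2 _ (R_mem_H2 hp)
      conv_lhs => rw [eq_char_add_M_R p]
      rw [mul_add' hu.bdd, mul_smul' _ (.inl hu.bdd), mul_char_zero, mul_M _ (.inl hu.bdd),
        inner_add_left, inner_smul_left, h3, inner_conj_symm, add_zero]
    rw [inner_sub_right, inner_smul_right, h1, h2, hR, mul_comm, sub_self]
  suffices (RK hu).adjoint h = ⟨_, hm⟩ from congrArg Subtype.val this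
  refine ext_inner_left ℂ fun g => ?_
  rw [ContinuousLinearMap.adjoint_inner_right]
  simp only [Submodule.coe_inner, coe_RK]
  rw [inner_sub_right, inner_smul_right, inner_eq_zero_symm.1 (inner_inner_eq_zero g), mul_zero,
    sub_zero, ← inner_conj_symm, inner_R_right (mem_K_iff.1 h.2).1, inner_conj_symm]

/-- The defect of the compressed shift has rank one and range spanned by the backward shift
of `u`. -/
theorem RK_adjoint_RK {u : L2} (hu : IsInner u) (h : K u) :
    RK hu ((RK hu).adjoint h) = h - ⟪R u, (h : L2)⟫_ℂ • ⟨R u, R_self_mem_K hu⟩ := by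
  apply Subtype.ext
  have h0 : ⟪𝐞 0, M 1 (h : L2)⟫_ℂ = 0 := by
    rw [inner_char_M]
    exact mem_H2_iff.1 (mem_K_iff.1 h.2).1 _ (by lia)
  rw [coe_RK, coe_adjoint_RK, map_sub, map_smul, R_apply (M 1 _), h0, zero_smul, sub_zero, M_M,
    show (-1 : ℤ) + 1 = 0 from rfl, M_zero]
  rfl

/-- The essentially bounded functions are dense in `K_u`: the projection of `zⁿ` to `K_u` is
`zⁿ - u q`, where the trigonometric polynomial `q` is the analytic part of `conj u zⁿ`. -/
theorem dense_bdd {u : L2} (hu : IsInner u) : Dense {f : K u | Bdd f} := by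
  let W : Submodule ℂ (K u) :=
    { carrier := {f | Bdd f}
      zero_mem' := bdd_zero
      add_mem' := fun hf hg => Bdd.add hf hg
      smul_mem' := fun c _ hf => Bdd.smul c hf }
  change Dense (W : Set (K u))
  rw [Submodule.dense_iff_topologicalClosure_eq_top, Submodule.topologicalClosure_eq_top_iff,
    Submodule.eq_bot_iff]
  intro g hg
  rw [Submodule.mem_orthogonal] at hg
  apply Subtype.ext
  refine eq_of_coeff fun n => ?_
  rw [Submodule.coe_zero, inner_zero_right]
  by_cases hn : n < 0
  · exact mem_H2_iff.1 (mem_K_iff.1 g.2).1 n hn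
  have key : ∀ k : ℤ, ⟪𝐞 k, mul (star u) (𝐞 n)⟫_ℂ = ⟪u, 𝐞 (n - k)⟫_ℂ := fun k => by
    rw [← inner_mul_left' hu.bdd, mul_char, ← inner_conj_symm, inner_char_M, inner_conj_symm]
  set q : L2 := ∑ k ∈ Finset.Icc 0 n, ⟪u, 𝐞 (n - k)⟫_ℂ • 𝐞 k with hq
  have hqc : ∀ m : ℤ, ⟪𝐞 m, q⟫_ℂ = if m ∈ Finset.Icc 0 n then ⟪u, 𝐞 (n - m)⟫_ℂ else 0 := by
    intro m
    simp [hq, inner_sum, inner_smul_right, inner_char_char]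
  have hqH : q ∈ H2 := mem_H2_iff.2 fun m hm => by
    rw [hqc, if_neg (by simp only [Finset.mem_Icc]; lia)]
  have hqb : Bdd q := by
    rw [hq]
    refine Finset.sum_induction _ Bdd (fun _ _ => Bdd.add) bdd_zero fun k _ => ?_
    exact (bdd_char k).smul _
  have hb : 𝐞 n - mul u q ∈ K u := by
    refine mem_K_iff.2 ⟨H2.sub_mem (char_mem_H2 (by lia)) (mul_mem_H2 hu hqH), fun p hp => ?_⟩
    rw [inner_sub_right, hu.inner_mul_mul, inner_mul_left' hu.bdd, ← inner_sub_right]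
    refine inner_eq_zero_of_coeff fun k => ?_
    by_cases hk : k < 0
    · exact .inl (mem_H2_iff.1 hp k hk)
    right
    rw [inner_sub_right, key, hqc]
    split_ifs with hk'
    · exact sub_self _
    · rw [sub_zero, inner_eq_zero_symm]
      exact mem_H2_iff.1 hu.1 _ (by simp only [Finset.mem_Icc] at hk'; lia)
  have h := hg ⟨_, hb⟩ ((bdd_char n).sub (hu.bdd.mul hqb))
  rwa [Submodule.coe_inner, inner_sub_left, (mem_K_iff.1 g.2).2 q hqH, sub_zero] at h

/-! ### Rank-two characterization of truncated Toeplitz operators -/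

/-- Two continuous functions on `K_u` that agree at essentially bounded arguments are equal. -/
theorem ext_of_bdd {u : L2} (hu : IsInner u) {X : Type*} [TopologicalSpace X] [T2Space X]
    {a b : K u → X} (ha : Continuous a) (hb : Continuous b)
    (h : ∀ f : K u, Bdd f → a f = b f) (f : K u) : a f = b f :=
  congrFun (ha.ext_on (dense_bdd hu) hb h) f

theorem inner_char_R_iterate {n : ℤ} (hn : 0 ≤ n) (f : L2) (k : ℕ) :
    ⟪𝐞 n, R^[k] f⟫_ℂ = ⟪𝐞 (n + k), f⟫_ℂ := by
  induction k generalizing f with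
  | zero => simp
  | succ k ih =>
    rw [Function.iterate_succ_apply, ih, inner_char_R (by lia), Nat.cast_succ, add_assoc]

theorem inner_R_iterate_left {g φ : L2} (hφ : φ ∈ H2) (k : ℕ) :
    ⟪R^[k] g, φ⟫_ℂ = ⟪g, M k φ⟫_ℂ := by
  rw [inner_M_right, ← sub_eq_zero, ← inner_sub_left]
  refine inner_eq_zero_of_coeff fun n => ?_
  by_cases hn : n < 0
  · exact .inr (mem_H2_iff.1 hφ n hn)
  · left
    rw [inner_sub_right, inner_char_R_iterate (by lia), inner_char_M, sub_neg_eq_add, sub_self]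

/-- The powers of the backward shift tend strongly to zero on `H²`, because each step removes the
leading Fourier coefficient from the norm. -/
theorem tendsto_R_iterate {f : L2} (hf : f ∈ H2) :
    Filter.Tendsto (fun n : ℕ => R^[n] f) Filter.atTop (nhds 0) := by
  have hs : HasSum (fun k : ℕ => ⟪f, 𝐞 k⟫_ℂ * ⟪𝐞 k, f⟫_ℂ) ⟪f, f⟫_ℂ := by
    refine (Function.Injective.hasSum_iff (g := ((↑) : ℕ → ℤ)) Nat.cast_injective
      fun n hn => ?_).2 (hasSum_inner_char f f)
    rw [mem_H2_iff.1 hf n (by_contra fun h => hn ⟨n.toNat, by simp; lia⟩), mul_zero]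
  have hn : ∀ n : ℕ, ⟪R^[n] f, R^[n] f⟫_ℂ
      = ⟪f, f⟫_ℂ - ∑ k ∈ Finset.range n, ⟪f, 𝐞 k⟫_ℂ * ⟪𝐞 k, f⟫_ℂ := by
    intro n
    induction n with
    | zero => simp
    | succ n ih =>
      have h0 : ⟪𝐞 0, R^[n] f⟫_ℂ = ⟪𝐞 n, f⟫_ℂ := by
        rw [inner_char_R_iterate le_rfl, zero_add]
      rw [Function.iterate_succ_apply', inner_R_R, ih, Finset.sum_range_succ,
        ← inner_conj_symm _ (𝐞 0), h0, inner_conj_symm, sub_sub]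
  have ht := (tendsto_const_nhds (x := ⟪f, f⟫_ℂ)).sub hs.tendsto_sum_nat
  simp only [← hn, sub_self] at ht
  have ht' := ht.norm
  simp only [norm_zero, inner_self_eq_norm_sq_to_K, norm_pow] at ht'
  rw [tendsto_zero_iff_norm_tendsto_zero]
  simpa using ht'.sqrt

/-- For bounded `f ∈ H²` and bounded `g`, the number `⟪g, φ f⟫` is obtained by expanding `f` in
its Fourier series, although the series of the products `zᵏ φ` need not converge in `L²(𝕋)`: the
factor `φ` is moved to the side of `g`. -/
theorem hasSum_inner_mul {f g φ : L2} (hf : f ∈ H2) (hg : Bdd g) (hfb : Bdd f) :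
    HasSum (fun k : ℕ => ⟪𝐞 k, f⟫_ℂ * ⟪g, M k φ⟫_ℂ) ⟪g, mul φ f⟫_ℂ := by
  have h1 : ⟪g, mul φ f⟫_ℂ = ⟪mul g (star φ), f⟫_ℂ := by
    rw [L2.inner_def, L2.inner_def]
    apply integral_congr_ae
    filter_upwards [coeFn_mul (f := φ) (g := f) (.inr hfb), coeFn_star' φ,
      coeFn_mul (f := g) (g := star φ) (.inl hg)] with x h1 h2 h3
    rw [h1, h3, h2]
    simp only [RCLike.inner_apply, map_mul, RCLike.conj_conj]
    ring
  have h2 : ∀ k : ℤ, ⟪mul g (star φ), 𝐞 k⟫_ℂ = ⟪g, M k φ⟫_ℂ := by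
    intro k
    rw [L2.inner_def, L2.inner_def]
    apply integral_congr_ae
    filter_upwards [coeFn_M k φ, coeFn_star' φ, coeFn_char k,
      coeFn_mul (f := g) (g := star φ) (.inl hg)] with x h1 h2 h3 h4
    rw [h1, h4, h2, h3]
    simp only [RCLike.inner_apply, map_mul, RCLike.conj_conj]
    ring
  rw [h1]
  refine ((Function.Injective.hasSum_iff (g := ((↑) : ℕ → ℤ)) Nat.cast_injective
      fun n hn => ?_).2 (hasSum_inner_char (mul g (star φ)) f)).congr_fun fun k => ?_
  · rw [mem_H2_iff.1 hf n (by_contra fun h => hn ⟨n.toNat, by simp; lia⟩), mul_zero]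
  · rw [Function.comp_apply, h2, mul_comm]

/-- The identity `A - S_v A S_u^* = Φ ⊗ k₀ᵘ + k₀ᵛ ⊗ Ψ`, `S_u` being the compressed shift, written
as an identity of sesquilinear forms. -/
def HasToeplitzDefect {u v : L2} (A : K u →L[ℂ] K v) (hu : IsInner u) (hv : IsInner v)
    (Φ : K v) (Ψ : K u) : Prop :=
  ∀ (f : K u) (g : K v), ⟪g, A f⟫_ℂ - ⟪RK hv g, A (RK hu f)⟫_ℂ
    = ⟪𝐞 0, (f : L2)⟫_ℂ * ⟪g, Φ⟫_ℂ + ⟪(g : L2), 𝐞 0⟫_ℂ * ⟪Ψ, f⟫_ℂ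

theorem mul_R {f : L2} (φ : L2) (hf : Bdd f) :
    mul φ (R f) = M (-1) (mul φ f - ⟪𝐞 0, f⟫_ℂ • φ) := by
  rw [R_apply, mul_M _ (.inr (hf.sub ((bdd_char 0).smul _))), mul_sub_char _ _ hf]

theorem IsATTOWithSymbol.exists_defect {u v φ : L2} {A : K u →L[ℂ] K v}
    (hA : IsATTOWithSymbol φ A) (hu : IsInner u) (hv : IsInner v) :
    ∃ Φ Ψ, HasToeplitzDefect A hu hv Φ Ψ := by
  refine ⟨PK v φ, PK u (star φ - conj ⟪𝐞 0, φ⟫_ℂ • 𝐞 0), fun f g => ?_⟩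
  revert f
  refine ext_of_bdd hu (by simp only [Submodule.coe_inner]; fun_prop)
    (by simp only [Submodule.coe_inner]; fun_prop) fun f hf => ?_
  have h1 : ⟪(R g : L2), mul φ (R f)⟫_ℂ = ⟪(g : L2), mul φ f⟫_ℂ
      - ⟪𝐞 0, (f : L2)⟫_ℂ * ⟪(g : L2), φ⟫_ℂ - ⟪(g : L2), 𝐞 0⟫_ℂ *
        (⟪star φ, (f : L2)⟫_ℂ - ⟪𝐞 0, (f : L2)⟫_ℂ * ⟪𝐞 0, φ⟫_ℂ) := by
    rw [mul_R _ hf, inner_R_M, inner_sub_right, inner_sub_right, inner_smul_right,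
      inner_smul_right, inner_mul_char hf]
  rw [hA f hf, hA (RK hu f) (Bdd.R hf), inner_PK, inner_PK, inner_PK, inner_PK_left,
    inner_sub_left, inner_smul_left, RCLike.conj_conj, coe_RK, coe_RK, h1]
  ring

theorem HasToeplitzDefect.isATTO {u v : L2} {A : K u →L[ℂ] K v} {hu : IsInner u} {hv : IsInner v}
    {Φ : K v} {Ψ : K u} (h : HasToeplitzDefect A hu hv Φ Ψ) : IsATTO A := by
  refine ⟨Φ + star (Ψ : L2), fun f hf => ext_inner_left ℂ ?_⟩
  refine ext_of_bdd hv (by simp only [Submodule.coe_inner]; fun_prop)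
    (by simp only [Submodule.coe_inner]; fun_prop) fun g hg => ?_
  have hcoe : ∀ {w : L2} (hw : IsInner w) (a : K w) (n : ℕ), ((RK hw)^[n] a : L2) = R^[n] a := by
    intro w hw a n
    induction n with
    | zero => rfl
    | succ n ih => rw [Function.iterate_succ_apply', Function.iterate_succ_apply', coe_RK, ih]
  have hfH := (mem_K_iff.1 f.2).1
  have hgH := (mem_K_iff.1 g.2).1
  -- the defect identity at the backward shifts of `f` and `g`, summed
  have hn : ∀ n : ℕ, ⟪g, A f⟫_ℂ - ⟪(RK hv)^[n] g, A ((RK hu)^[n] f)⟫_ℂ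
      = ∑ k ∈ Finset.range n, ⟪𝐞 k, (f : L2)⟫_ℂ * ⟪(g : L2), M k (Φ : L2)⟫_ℂ
        + conj (∑ k ∈ Finset.range n, ⟪𝐞 k, (g : L2)⟫_ℂ * ⟪(f : L2), M k (Ψ : L2)⟫_ℂ) := by
    intro n
    induction n with
    | zero => simp
    | succ n ih =>
      have hd := h ((RK hu)^[n] f) ((RK hv)^[n] g)
      rw [← inner_conj_symm _ (𝐞 0), ← inner_conj_symm Ψ, Submodule.coe_inner (K v) _ Φ,
        Submodule.coe_inner (K u) _ Ψ, hcoe, hcoe,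
        inner_char_R_iterate le_rfl, inner_char_R_iterate le_rfl, zero_add,
        inner_R_iterate_left (mem_K_iff.1 Φ.2).1, inner_R_iterate_left (mem_K_iff.1 Ψ.2).1,
        ← Function.iterate_succ_apply' (RK hu), ← Function.iterate_succ_apply' (RK hv)] at hd
      rw [Finset.sum_range_succ, Finset.sum_range_succ, map_add, map_mul]
      linear_combination ih + hd
  have hlim : ∀ {w : L2} (hw : IsInner w) (a : K w),
      Filter.Tendsto (fun n : ℕ => (RK hw)^[n] a) Filter.atTop (nhds 0) := by
    intro w hw a
    rw [tendsto_subtype_rng]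
    simp only [hcoe]
    exact tendsto_R_iterate (mem_K_iff.1 a.2).1
  have h1 : Filter.Tendsto (fun n : ℕ => ⟪g, A f⟫_ℂ - ⟪(RK hv)^[n] g, A ((RK hu)^[n] f)⟫_ℂ)
      Filter.atTop (nhds ⟪g, A f⟫_ℂ) := by
    simpa using (tendsto_const_nhds (x := ⟪g, A f⟫_ℂ)).sub
      ((hlim hv g).inner (𝕜 := ℂ) ((A.continuous.tendsto _).comp (hlim hu f)))
  have h2 := (hasSum_inner_mul (φ := Φ) hfH hg hf).tendsto_sum_nat.add
    ((RCLike.continuous_conj.tendsto _).comp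
      (hasSum_inner_mul (φ := Ψ) hgH hf hg).tendsto_sum_nat)
  rw [tendsto_nhds_unique h1 (h2.congr fun n => (hn n).symm), inner_PK, inner_conj_symm]
  have h3 : mul (Φ + star (Ψ : L2)) f = mul (Φ : L2) f + mul (star (Ψ : L2)) f := by
    apply Lp.ext
    filter_upwards [coeFn_mul (f := Φ + star (Ψ : L2)) (.inr hf), coeFn_mul (f := Φ) (.inr hf),
      coeFn_mul (f := star (Ψ : L2)) (.inr hf), Lp.coeFn_add (Φ : L2) (star (Ψ : L2)),
      Lp.coeFn_add (mul (Φ : L2) f) (mul (star (Ψ : L2)) f)] with x h1 h2 h3 h4 h5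
    rw [h1, h5, h4, Pi.add_apply, Pi.add_apply, h2, h3, add_mul]
  rw [h3, inner_add_right]
  congr 1
  rw [L2.inner_def, L2.inner_def]
  apply integral_congr_ae
  filter_upwards [coeFn_mul (f := Ψ) (g := g) (.inr hg), coeFn_mul (f := star (Ψ : L2)) (.inr hf),
    coeFn_star' (Ψ : L2)] with x h1 h2 h3
  rw [h1, h2, h3]
  simp only [RCLike.inner_apply, map_mul]
  ring

/-! ### Commutation relations of truncated Hankel operators -/

/-- The projection `I - P` in the definition of a truncated Hankel operator is redundant. -/
theorem PK_flipJ_sub_P {v : L2} (h : L2) : PK v (flipJ (h - P h)) = PK v (flipJ h) := by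
  refine ext_inner_left ℂ fun g => ?_
  have h1 : flipJ (h - P h) = flipJ h - flipJ (P h) := by
    change M (-1) (reflect _) = M (-1) (reflect _) - M (-1) (reflect _)
    rw [reflect_sub, map_sub]
  have h2 : ⟪(g : L2), flipJ (P h)⟫_ℂ = 0 :=
    inner_flipJ_eq_zero (mem_K_iff.1 g.2).1 (Submodule.starProjection_apply_mem H2 h)
  rw [inner_PK, inner_PK, h1, inner_sub_right, h2, sub_zero]

theorem flipJ_mul_R {f : L2} (φ : L2) (hf : Bdd f) :
    flipJ (mul φ (R f)) = reflect (mul φ f) - ⟪𝐞 0, f⟫_ℂ • reflect φ := by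
  change M (-1) (reflect _) = _
  rw [mul_R _ hf, reflect_M, M_M, show (-1 : ℤ) + - -1 = 0 from rfl, M_zero, reflect_sub,
    reflect_smul]

theorem inner_char_reflect_mul {f : L2} (φ : L2) (hf : Bdd f) :
    ⟪𝐞 0, reflect (mul φ f)⟫_ℂ = ⟪star φ, f⟫_ℂ := by
  rw [inner_char_reflect, neg_zero, inner_mul_char hf]

/-- The intertwining relation `B S_u^* - S_v B = k₀ᵛ ⊗ P_u conj φ - P_v (conj φ^) ⊗ k₀ᵘ` of a
truncated Hankel operator with the compressed shifts. -/
theorem IsATHOWithSymbol.inner_apply_RK {u v φ : L2} {B : K u →L[ℂ] K v}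
    (hB : IsATHOWithSymbol φ B) (hu : IsInner u) (hv : IsInner v) (f : K u) (g : K v) :
    ⟪g, B (RK hu f)⟫_ℂ = ⟪RK hv g, B f⟫_ℂ + ⟪(g : L2), 𝐞 0⟫_ℂ * ⟪star φ, (f : L2)⟫_ℂ
      - ⟪𝐞 0, (f : L2)⟫_ℂ * ⟪(g : L2), reflect φ⟫_ℂ := by
  revert f
  refine ext_of_bdd hu (by simp only [Submodule.coe_inner]; fun_prop)
    (by simp only [Submodule.coe_inner]; fun_prop) fun f hf => ?_
  have h1 : ⟪(R g : L2), flipJ (mul φ f)⟫_ℂ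
      = ⟪(g : L2), reflect (mul φ f)⟫_ℂ - ⟪(g : L2), 𝐞 0⟫_ℂ * ⟪star φ, (f : L2)⟫_ℂ := by
    rw [← inner_char_reflect_mul φ hf, ← inner_R_M]
    rfl
  rw [hB f hf, hB (RK hu f) (Bdd.R hf), PK_flipJ_sub_P, PK_flipJ_sub_P, inner_PK, inner_PK, coe_RK,
    coe_RK, flipJ_mul_R φ hf, h1, inner_sub_right, inner_smul_right]
  ring

/-- The backward shift of `u` is an essentially bounded member of `K_u`, so that the symbol
determines the value of the operator there. -/
theorem IsATHOWithSymbol.apply_R_self {u v φ : L2} {B : K u →L[ℂ] K v}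
    (hB : IsATHOWithSymbol φ B) (hu : IsInner u) :
    B ⟨R u, R_self_mem_K hu⟩
      = PK v (star (mul (hat u) (hat φ))) - ⟪𝐞 0, u⟫_ℂ • PK v (reflect φ) := by
  rw [hB ⟨R u, R_self_mem_K hu⟩ hu.bdd.R, PK_flipJ_sub_P, flipJ_mul_R φ hu.bdd, map_sub, map_smul,
    star_mul_hat_hat φ hu]

theorem IsATHOWithSymbol.inner_R_self {u v φ : L2} {B : K u →L[ℂ] K v}
    (hB : IsATHOWithSymbol φ B) (hu : IsInner u) (hv : IsInner v) (f : K u) :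
    ⟪R v, (B f : L2)⟫_ℂ = ⟪star (mul (hat v) φ), (f : L2)⟫_ℂ
      - ⟪v, 𝐞 0⟫_ℂ * ⟪star φ, (f : L2)⟫_ℂ := by
  revert f
  refine ext_of_bdd hu (by fun_prop) (by fun_prop) fun f hf => ?_
  have h1 : ⟪R v, flipJ (mul φ f)⟫_ℂ
      = ⟪v, reflect (mul φ f)⟫_ℂ - ⟪v, 𝐞 0⟫_ℂ * ⟪star φ, (f : L2)⟫_ℂ := by
    rw [← inner_char_reflect_mul φ hf, ← inner_R_M]
    rfl
  rw [hB f hf, PK_flipJ_sub_P]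
  refine (inner_PK (u := v) ⟨R v, R_self_mem_K hv⟩ _).trans ?_
  rw [h1, inner_reflect_mul φ hv hf]

/-! ### The product of two truncated Hankel operators -/

/-- The defect of a product of truncated Hankel operators is, up to the terms allowed for a
truncated Toeplitz operator, the difference of two rank-one operators. -/
theorem exists_defect_comp {u v w φ₁ φ₂ : L2} (hu : IsInner u) (hv : IsInner v) (hw : IsInner w)
    {B₁ : K v →L[ℂ] K w} {B₂ : K u →L[ℂ] K v}
    (hB₁ : IsATHOWithSymbol φ₁ B₁) (hB₂ : IsATHOWithSymbol φ₂ B₂) :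
    ∃ (Φ : K w) (Ψ : K u), ∀ (f : K u) (g : K w),
      ⟪g, B₁ (B₂ f)⟫_ℂ - ⟪RK hw g, B₁ (B₂ (RK hu f))⟫_ℂ
        = ⟪star (mul (hat v) φ₂), (f : L2)⟫_ℂ * ⟪(g : L2), star (mul (hat v) (hat φ₁))⟫_ℂ
          - ⟪star φ₂, (f : L2)⟫_ℂ * ⟪(g : L2), star (hat φ₁)⟫_ℂ
          + ⟪𝐞 0, (f : L2)⟫_ℂ * ⟪g, Φ⟫_ℂ + ⟪(g : L2), 𝐞 0⟫_ℂ * ⟪Ψ, f⟫_ℂ := by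
  set F : K v := PK v (reflect φ₂) with hF
  set k : K v := ⟨k0 v, k0_mem_K hv⟩
  set r : K v := ⟨R v, R_self_mem_K hv⟩
  refine ⟨B₁ (RK hv F) + ⟪k, F⟫_ℂ • PK w (reflect φ₁),
    (B₂.comp (RK hu)).adjoint (PK v (star φ₁)), fun f g => ?_⟩
  -- `B₂ S_u^* = S_v B₂ + k₀ᵛ ⊗ P_u (conj φ₂) - F ⊗ k₀ᵘ`
  have h2 : B₂ (RK hu f) = (RK hv).adjoint (B₂ f) + ⟪star φ₂, (f : L2)⟫_ℂ • k
      - ⟪𝐞 0, (f : L2)⟫_ℂ • F := by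
    refine ext_inner_left ℂ fun y => ?_
    rw [hB₂.inner_apply_RK hu hv, inner_sub_right, inner_add_right, inner_smul_right_K,
      inner_smul_right_K, ContinuousLinearMap.adjoint_inner_right, hF, inner_PK,
      Submodule.coe_inner _ y k, inner_k0_right y]
    ring
  have hRk : RK hv k = -(⟪v, 𝐞 0⟫_ℂ • r) := Subtype.ext (R_k0 v)
  have hB₁r : B₁ r = PK w (star (mul (hat v) (hat φ₁))) - ⟪𝐞 0, v⟫_ℂ • PK w (reflect φ₁) :=
    hB₁.apply_R_self hv
  -- the backward shift of `B₂ S_u^* f`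
  have h3 : RK hv (B₂ (RK hu f)) = B₂ f - (⟪R v, (B₂ f : L2)⟫_ℂ
      + ⟪v, 𝐞 0⟫_ℂ * ⟪star φ₂, (f : L2)⟫_ℂ) • r - ⟪𝐞 0, (f : L2)⟫_ℂ • RK hv F := by
    rw [h2, map_sub, map_add, map_smul, map_smul, RK_adjoint_RK, hRk]
    module
  -- the value at the origin of `B₂ S_u^* f`
  have h4 : ⟪𝐞 0, (B₂ (RK hu f) : L2)⟫_ℂ = -(⟪𝐞 0, v⟫_ℂ * ⟪R v, (B₂ f : L2)⟫_ℂ)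
      + ⟪star φ₂, (f : L2)⟫_ℂ * (1 - ⟪v, 𝐞 0⟫_ℂ * ⟪𝐞 0, v⟫_ℂ)
      - ⟪𝐞 0, (f : L2)⟫_ℂ * ⟪k, F⟫_ℂ := by
    have hk' : ⟪k, (RK hv).adjoint (B₂ f)⟫_ℂ = -(⟪𝐞 0, v⟫_ℂ * ⟪R v, (B₂ f : L2)⟫_ℂ) := by
      rw [ContinuousLinearMap.adjoint_inner_right, hRk, inner_neg_left, inner_smul_left_K,
        inner_conj_symm]
      rfl
    have hkk : ⟪k, k⟫_ℂ = 1 - ⟪v, 𝐞 0⟫_ℂ * ⟪𝐞 0, v⟫_ℂ := by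
      rw [← inner_char_k0]
      exact inner_k0 k
    rw [← inner_k0]
    change ⟪k, B₂ (RK hu f)⟫_ℂ = _
    rw [h2, inner_sub_right, inner_add_right, inner_smul_right_K, inner_smul_right_K, hk', hkk]
  have h5 := hB₁.inner_apply_RK hv hw (B₂ (RK hu f)) g
  have h6 : ⟪(B₂.comp (RK hu)).adjoint (PK v (star φ₁)), f⟫_ℂ
      = ⟪star φ₁, (B₂ (RK hu f) : L2)⟫_ℂ := by
    rw [ContinuousLinearMap.adjoint_inner_left, inner_PK_left]
    rfl
  have h7 := congrArg (fun y => ⟪g, B₁ y⟫_ℂ) h3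
  simp only [map_sub, map_smul, inner_sub_right, inner_smul_right_K, hB₁r, inner_PK] at h7
  rw [h7, h4, hB₂.inner_R_self hu hv] at h5
  rw [inner_add_right, inner_smul_right_K, h6, inner_PK g, star_hat]
  linear_combination h5

end TruncatedHankel

end

open TruncatedHankel
theorem mainTheorem8 (u v w : L2) (hu : IsInner u) (hv : IsInner v) (hw : IsInner w)
    (φ₁ φ₂ : L2) (hφ₁ : star φ₁ ∈ K (mul v (hat w))) (hφ₂ : star φ₂ ∈ K (mul u (hat v)))
    (B₁ : K v →L[ℂ] K w) (B₂ : K u →L[ℂ] K v)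
    (hB₁ : IsATHOWithSymbol φ₁ B₁) (hB₂ : IsATHOWithSymbol φ₂ B₂) :
    IsATTO (B₁.comp B₂) ↔
      ∃ Φ : K w, ∃ Ψ : K u,
        (tensor (PK w (star (mul (hat v) (hat φ₁)))) (PK u (star (mul (hat v) φ₂))) -
            tensor (PK w (star (hat φ₁))) (PK u (star φ₂)) : K u →L[ℂ] L2) =
          tensor Φ (k0 u) + tensor (k0 w) Ψ := by
  obtain ⟨Φ₀, Ψ₀, h₀⟩ := exists_defect_comp hu hv hw hB₁ hB₂
  -- the operator identity, tested against elements of `K_w`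
  have key : ∀ (Φ : K w) (Ψ : K u),
      ((tensor (PK w (star (mul (hat v) (hat φ₁)))) (PK u (star (mul (hat v) φ₂))) -
            tensor (PK w (star (hat φ₁))) (PK u (star φ₂)) : K u →L[ℂ] L2) =
          tensor Φ (k0 u) + tensor (k0 w) Ψ) ↔
        ∀ (f : K u) (g : K w),
          ⟪star (mul (hat v) φ₂), (f : L2)⟫_ℂ * ⟪(g : L2), star (mul (hat v) (hat φ₁))⟫_ℂ
            - ⟪star φ₂, (f : L2)⟫_ℂ * ⟪(g : L2), star (hat φ₁)⟫_ℂ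
          = ⟪fourierLp 2 0, (f : L2)⟫_ℂ * ⟪g, Φ⟫_ℂ
            + ⟪(g : L2), fourierLp 2 0⟫_ℂ * ⟪Ψ, f⟫_ℂ := by
    intro Φ Ψ
    rw [ContinuousLinearMap.ext_iff]
    refine forall_congr' fun f => ?_
    have e1 : ∀ a b : L2, tensor (PK w a) (PK u b) f =
        ((⟪b, (f : L2)⟫_ℂ • PK w a : K w) : L2) := by
      intro a b
      rw [← inner_PK_left f b]
      rfl
    have e2 : tensor (Φ : L2) (k0 u) f = ((⟪fourierLp 2 0, (f : L2)⟫_ℂ • Φ : K w) : L2) := by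
      rw [← inner_k0 f]
      rfl
    have e3 : tensor (k0 w) (Ψ : L2) f = ((⟪Ψ, f⟫_ℂ • ⟨k0 w, k0_mem_K hw⟩ : K w) : L2) := rfl
    rw [sub_apply, add_apply, e1, e1, e2, e3,
      ← Submodule.coe_sub, ← Submodule.coe_add, Subtype.coe_inj]
    refine (ext_iff_inner_left ℂ).trans (forall_congr' fun g => ?_)
    have e4 : ⟪g, (⟨k0 w, k0_mem_K hw⟩ : K w)⟫_ℂ = ⟪(g : L2), fourierLp 2 0⟫_ℂ :=
      inner_k0_right g
    rw [inner_sub_right, inner_add_right, inner_smul_right_K, inner_smul_right_K, inner_smul_right_K,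
      inner_smul_right_K, e4, inner_PK, inner_PK, mul_comm ⟪Ψ, f⟫_ℂ]
  simp only [key]
  constructor
  · rintro ⟨φ, hφ⟩
    obtain ⟨Φ, Ψ, h⟩ := hφ.exists_defect hu hw
    refine ⟨Φ - Φ₀, Ψ - Ψ₀, fun f g => ?_⟩
    rw [inner_sub_right, inner_sub_left]
    have h' := h f g
    simp only [ContinuousLinearMap.comp_apply] at h'
    linear_combination h' - h₀ f g
  · rintro ⟨Φ, Ψ, h⟩
    refine HasToeplitzDefect.isATTO (hu := hu) (hv := hw) (Φ := Φ + Φ₀) (Ψ := Ψ + Ψ₀) fun f g => ?_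
    rw [inner_add_right, inner_add_left, ContinuousLinearMap.comp_apply,
      ContinuousLinearMap.comp_apply]
    linear_combination h f g + h₀ f g
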